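/- Let $M$ be a smooth $n$-dimensional manifold with tangent bundle $TM$, let $TM_0$ be $TM$ without the zero section, and let $\pi: SM=TM_0/\mathbb R^+\to M$ be the projective sphere bundle. Let $F:TM_0\to(0,\infty)$ be a Finsler structure: $F$ is smooth, $F(x,\lambda y)=\lambda F(x,y)$ for $\lambda>0$, and in natural coordinates $(x^i,y^i)$ the matrix $g_{ij}=\frac12[F^2]_{y^iy^j}$ is positive definite on $TM_0$. With $(g^{ij})=(g_{ij})^{-1}$ put $$G^i=\tfrac14 g^{ij}\big([F^2]_{y^jx^k}y^k-[F^2]_{x^j}\big),\quad \frac{\delta}{\delta x^i}=\frac{\partial}{\partial x^i}-\frac{\partial G^j}{\partial y^i}\frac{\partial}{\partial y^j},\quad \delta y^i=\frac1F\Big(dy^i+\frac{\partial G^i}{\partial y^j}dx^j\Big),\quad A_{ijk}=\tfrac14F[F^2]_{y^iy^jy^k}.$$ Equip $SM$ with the Sasaki-type metric $$g^{T(SM)}=g_{ij}\,dx^i\otimes dx^j+(g_{ij}-F_{y^i}F_{y^j})\,\delta y^i\otimes\delta y^j ,$$ (forms on $SM$ being written as forms on $TM_0$), let $V(SM)=\ker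 d\pi$, let $H(SM)$ be its orthogonal complement (spanned by the $\delta/\delta x^i$), and let $p^\perp$ be the orthogonal projection onto $H(SM)$. The Bott connection $\widetilde\nabla$ on $H(SM)$ is given by $\widetilde\nabla_XU=p^\perp[X,U]$ for $X$ in $V(SM)$ and $\widetilde\nabla_XU=p^\perp\nabla_XU$ for $X$ in $H(SM)$, where $\nabla$ is the Levi-Civita connection of $g^{T(SM)}$. Its dual $\widetilde\nabla^*$ is defined by $d\langle U,V\rangle=\langle\widetilde\nabla U,V\rangle+\langle U,\widetilde\nabla^*V\rangle$ for sections $U,V$ of $H(SM)$. The Cartan endomorphism is $H=\frac12(\widetilde\nabla^*-\widetilde\nabla)$ and the Cartan form is the one-form $\eta=\mathrm{tr}[H]$ on $SM$. Let $\sigma$ be a smooth function on $M$, also viewed as a function on $SM$ via $\pi$, let $\bar F=e^{\sigma}F$, and let $\bar\eta$ be the Cartan form of $(M,\bar F)$. Then $\bar\eta=\eta$ if and only if, on $SM$, $$\mathbf G(\sigma)\,\mathbf I+\mathbf A(\mathbf I^*,d\sigma^*)=0\quad\text{and}\quad\langle\mathbf I^*,d\sigma^*\rangle=0,$$ where $\mathbf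 G=\frac{y^i}{F}\frac{\delta}{\delta x^i}$ is the Reeb vector field, $\mathbf A=A_{ijk}\,dx^i\otimes dx^j\otimes dx^k$ the Cartan tensor (so that $\mathbf A(\mathbf I^*,d\sigma^*)$ is a one-form), $\mathbf I=g^{ij}A_{ijk}\,dx^k$ the usual Cartan form, $\langle\cdot,\cdot\rangle=g^{T(SM)}$, and $\mathbf I^*,d\sigma^*$ are the vector fields dual to $\mathbf I,d\sigma$ with respect to $g^{T(SM)}$; all these objects are those of $F$. -/

import Mathlib

open scoped Manifold ContDiff

noncomputable section

namespace Finsler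

/-- The coordinate space `ℝⁿ`. -/
abbrev E (n : ℕ) := EuclideanSpace ℝ (Fin n)

/-- Natural coordinates `(x, y)` on the tangent bundle over a coordinate domain; also the coordinate
space of tangent vectors `ξ = ξ.1ⁱ ∂/∂xⁱ + ξ.2ⁱ ∂/∂yⁱ` to the tangent bundle. -/
abbrev P (n : ℕ) := E n × E n

variable {n : ℕ}

/-- The `i`-th standard basis vector of `ℝⁿ`. -/
def basisVec (i : Fin n) : E n := EuclideanSpace.single i (1 : ℝ)

/-- `∂f/∂xⁱ`. -/
def pdx (i : Fin n) (f : P n → ℝ) : P n → ℝ := fun p => fderiv ℝ f p (basisVec i, 0)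

/-- `∂f/∂yⁱ`. -/
def pdy (i : Fin n) (f : P n → ℝ) : P n → ℝ := fun p => fderiv ℝ f p (0, basisVec i)

/-! ### Local Finsler geometry

Below `L : P n → ℝ` is the expression `L(x, y)` of a Finsler function in natural coordinates.

Tensors on the projective sphere bundle `SM = TM₀ / ℝ⁺` are represented by their pull-backs to the
slit tangent bundle `TM₀` (`TM₀ → SM` is a surjective submersion, so nothing is lost), and vector
fields on `SM` by vector fields on `TM₀` projecting to them. -/

/-- The square `L²`. -/
def sq (L : P n → ℝ) : P n → ℝ := fun p => L p ^ 2

/-- The fundamental tensor `g_{ij} = ½ [L²]_{yⁱyʲ}`. -/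
def fundMatrix (L : P n → ℝ) (p : P n) : Matrix (Fin n) (Fin n) ℝ :=
  Matrix.of fun i j => 1 / 2 * pdy j (pdy i (sq L)) p

/-- The inverse matrix `g^{ij}`. -/
def fundInv (L : P n → ℝ) (p : P n) : Matrix (Fin n) (Fin n) ℝ := (fundMatrix L p)⁻¹

/-- The spray coefficients `Gⁱ = ¼ g^{ij} ([L²]_{yʲxᵏ} yᵏ - [L²]_{xʲ})`. -/
def spray (L : P n → ℝ) (i : Fin n) : P n → ℝ := fun p =>
  1 / 4 * ∑ j, fundInv L p i j * ((∑ k, pdx k (pdy j (sq L)) p * p.2 k) - pdx j (sq L) p)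

/-- The horizontal fields `δ/δxⁱ = ∂/∂xⁱ - (∂Gʲ/∂yⁱ) ∂/∂yʲ`. -/
def deltaX (L : P n → ℝ) (i : Fin n) : P n → P n := fun p =>
  (basisVec i, -∑ j, pdy i (spray L j) p • basisVec j)

/-- The vertical fields `δ/δyⁱ = L ∂/∂yⁱ`. -/
def deltaY (L : P n → ℝ) (i : Fin n) : P n → P n := fun p => (0, L p • basisVec i)

/-- The coframe form `δyⁱ = (1/L) (dyⁱ + (∂Gⁱ/∂yʲ) dxʲ)` at `p`, evaluated at `ξ`.
(The forms `δxⁱ = dxⁱ` are just `ξ ↦ ξ.1 i`.) -/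
def dyForm (L : P n → ℝ) (i : Fin n) (p ξ : P n) : ℝ :=
  1 / L p * (ξ.2 i + ∑ j, pdy j (spray L i) p * ξ.1 j)

/-- The (pull-back to `TM₀` of the) Sasaki-type metric of `SM`. For an orthonormal coframe
`ω¹, …, ωⁿ` of `g` with `ωⁿ = L_{yⁱ} dxⁱ`, `ωⁱ = vⁱ_j dxʲ`, `ω^{n+i} = -vⁱ_j δyʲ`, it is
`∑_{i ≤ n} ωⁱ ⊗ ωⁱ + ∑_{α ≤ n-1} ω^{n+α} ⊗ ω^{n+α}`, that is
`g_{ij} dxⁱ ⊗ dxʲ + (g_{ij} δyⁱ ⊗ δyʲ - ω^{2n} ⊗ ω^{2n})` with `ω^{2n} = -L_{yⁱ} δyⁱ`. -/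
def sasaki (L : P n → ℝ) (p ξ ζ : P n) : ℝ :=
  (∑ i, ∑ j, fundMatrix L p i j * ξ.1 i * ζ.1 j) +
  ((∑ i, ∑ j, fundMatrix L p i j * dyForm L i p ξ * dyForm L j p ζ) -
    (∑ i, pdy i L p * dyForm L i p ξ) * (∑ j, pdy j L p * dyForm L j p ζ))

/-- The function `⟨U, V⟩` of two vector fields. -/
def innerFn (L : P n → ℝ) (U V : P n → P n) : P n → ℝ := fun p => sasaki L p (U p) (V p)

/-- The horizontal part `p^⊥ X` of a vector field. -/
def horiz (L : P n → ℝ) (X : P n → P n) : P n → P n := fun p => ∑ i, (X p).1 i • deltaX L i p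

/-- The vertical part `p X` of a vector field. -/
def vert (L : P n → ℝ) (X : P n → P n) : P n → P n := fun p => X p - horiz L X p

/-- The derivative `X(f)` of a function along a vector field. -/
def along (X : P n → P n) (f : P n → ℝ) : P n → ℝ := fun p => fderiv ℝ f p (X p)

/-- `⟨∇_X U, V⟩` for the Levi-Civita connection `∇` of the Sasaki-type metric (Koszul formula). -/
def koszul (L : P n → ℝ) (X U V : P n → P n) : P n → ℝ := fun p =>
  1 / 2 * (along X (innerFn L U V) p + along U (innerFn L X V) p - along V (innerFn L X U) p
    + innerFn L (VectorField.lieBracket ℝ X U) V p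
    - innerFn L (VectorField.lieBracket ℝ X V) U p
    - innerFn L (VectorField.lieBracket ℝ U V) X p)

/-- The projected Levi-Civita connection `p^⊥ ∇_X U`: the horizontal field `W` with
`⟨W, δ/δxⁱ⟩ = ⟨∇_X U, δ/δxⁱ⟩` for all `i` (recall `⟨δ/δxⁱ, δ/δxʲ⟩ = g_{ij}`). -/
def projLC (L : P n → ℝ) (X U : P n → P n) : P n → P n := fun p =>
  ∑ i, ∑ j, (fundInv L p i j * koszul L X U (deltaX L i) p) • deltaX L j p

/-- The Bott connection on the horizontal bundle: `p^⊥[X, U]` for `X` vertical and `p^⊥ ∇_X U` for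
`X` horizontal, `U` being a horizontal field. -/
def bott (L : P n → ℝ) (X U : P n → P n) : P n → P n := fun p =>
  horiz L (VectorField.lieBracket ℝ (vert L X) U) p + projLC L (horiz L X) U p

/-- The dual of the Bott connection: the horizontal field `W` with
`X⟨U, V⟩ = ⟨∇ᴮ_X U, V⟩ + ⟨U, W⟩` for `U = δ/δx¹, …, δ/δxⁿ`. -/
def bottDual (L : P n → ℝ) (X V : P n → P n) : P n → P n := fun p =>
  ∑ i, ∑ j, (fundInv L p i j *
    (along X (innerFn L (deltaX L i) V) p - innerFn L (bott L X (deltaX L i)) V p)) • deltaX L j p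

/-- The Cartan endomorphism `H(X) U = ½ (∇^{B,*}_X U - ∇ᴮ_X U)`. -/
def cartanEndo (L : P n → ℝ) (X U : P n → P n) : P n → P n := fun p =>
  (1 / 2 : ℝ) • (bottDual L X U p - bott L X U p)

/-- The Cartan form `η = tr H`: `η(X)` is the trace of the endomorphism `H(X)` of the horizontal
bundle, computed in the frame `δ/δx¹, …, δ/δxⁿ`, whose dual frame is `dx¹, …, dxⁿ`. -/
def cartanForm (L : P n → ℝ) (X : P n → P n) : P n → ℝ := fun p =>
  ∑ i, (cartanEndo L X (deltaX L i) p).1 i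

/-- The Reeb field `G = (yⁱ/L) δ/δxⁱ`. -/
def reeb (L : P n → ℝ) : P n → P n := fun p => ∑ i, (p.2 i / L p) • deltaX L i p

/-- `A_{ijk} = ¼ L [L²]_{yⁱyʲyᵏ}`. -/
def cartanCoeff (L : P n → ℝ) (i j k : Fin n) (p : P n) : ℝ :=
  1 / 4 * L p * pdy k (pdy j (pdy i (sq L))) p

/-- The Cartan tensor `A = A_{ijk} dxⁱ ⊗ dxʲ ⊗ dxᵏ` at `p`. -/
def cartanTensor (L : P n → ℝ) (p ξ ζ τ : P n) : ℝ :=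
  ∑ i, ∑ j, ∑ k, cartanCoeff L i j k p * ξ.1 i * ζ.1 j * τ.1 k

/-- The usual Cartan form `I = g^{ij} A_{ijk} dxᵏ` at `p`. -/
def usualCartanForm (L : P n → ℝ) (p ξ : P n) : ℝ :=
  ∑ k, (∑ i, ∑ j, fundInv L p i j * cartanCoeff L i j k p) * ξ.1 k

/-- The vector at `p` dual to a covector `α` with respect to the Sasaki-type metric of `SM`. The
tangent space of `SM` is represented by the kernel of `dL`, spanned by the `δ/δxⁱ` and by the
`aⁱ δ/δyⁱ` with `L_{yⁱ} aⁱ = 0`; the inverse metric is `g^{ij}` on the first and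
`g^{ij} - yⁱyʲ/L²` on the second. -/
def sharp (L : P n → ℝ) (p : P n) (α : P n → ℝ) : P n :=
  (∑ i, ∑ j, (fundInv L p i j * α (deltaX L i p)) • deltaX L j p) +
  ∑ i, ∑ j, ((fundInv L p i j - p.2 i * p.2 j / L p ^ 2) * α (deltaY L i p)) • deltaY L j p

/-! ### Finsler manifolds -/

variable {M : Type*} [TopologicalSpace M] [ChartedSpace (E n) M]

/-- The expression of a function on `TM` in the natural coordinates `(x, y)` induced by the local
coordinate system `e` of `M`. -/
def localRep (F : TangentBundle (𝓡 n) M → ℝ) (e : OpenPartialHomeomorph M (E n)) : P n → ℝ :=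
  fun p => F ⟨e.symm p.1, mfderiv (𝓡 n) (𝓡 n) e.symm p.1 p.2⟩

/-- The expression of `σ ∘ π` in natural coordinates, for a function `σ` on `M`. -/
def localPull (σ : M → ℝ) (e : OpenPartialHomeomorph M (E n)) : P n → ℝ := fun p => σ (e.symm p.1)

/-- The domain of the natural coordinates on the slit tangent bundle `TM₀`. -/
def slitDomain (e : OpenPartialHomeomorph M (E n)) : Set (P n) := {p | p.1 ∈ e.target ∧ p.2 ≠ 0}

/-- `F` is a Finsler structure on `M` (only its values off the zero section matter). -/
structure IsFinsler [IsManifold (𝓡 n) ∞ M] (F : TangentBundle (𝓡 n) M → ℝ) : Prop where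
  smooth : ContMDiffOn (𝓡 n).tangent 𝓘(ℝ, ℝ) ∞ F {v | v.2 ≠ 0}
  pos : ∀ (x : M) (v : TangentSpace (𝓡 n) x), v ≠ 0 → 0 < F ⟨x, v⟩
  homog : ∀ (x : M) (v : TangentSpace (𝓡 n) x), v ≠ 0 → ∀ c : ℝ, 0 < c →
    F ⟨x, c • v⟩ = c * F ⟨x, v⟩
  posDef : ∀ e ∈ IsManifold.maximalAtlas (𝓡 n) ∞ M, ∀ p ∈ slitDomain e,
    (fundMatrix (localRep F e) p).PosDef

/-- The conformal deformation `e^σ F`. -/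
def conformal (σ : M → ℝ) (F : TangentBundle (𝓡 n) M → ℝ) : TangentBundle (𝓡 n) M → ℝ :=
  fun v => Real.exp (σ v.proj) * F v

/-- Equality of the Cartan forms of two Finsler structures: in every local coordinate system they
take the same values on all smooth vector fields. -/
def CartanFormsAgree (F₁ F₂ : TangentBundle (𝓡 n) M → ℝ) : Prop :=
  ∀ e ∈ IsManifold.maximalAtlas (𝓡 n) ∞ M, ∀ X : P n → P n, ContDiffOn ℝ ∞ X (slitDomain e) →
    ∀ p ∈ slitDomain e, cartanForm (localRep F₁ e) X p = cartanForm (localRep F₂ e) X p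

/-- The equations `G(σ) I + A(I^*, dσ^*) = 0` (between one-forms) and `⟨I^*, dσ^*⟩ = 0` at `p`,
where `s` is the expression of `σ ∘ π` in the natural coordinates. -/
def ConformalEqs (L s : P n → ℝ) (p : P n) : Prop :=
  (∀ ξ : P n, along (reeb L) s p * usualCartanForm L p ξ +
    cartanTensor L p (sharp L p (usualCartanForm L p)) (sharp L p (fderiv ℝ s p)) ξ = 0) ∧
  sasaki L p (sharp L p (usualCartanForm L p)) (sharp L p (fderiv ℝ s p)) = 0

end Finsler

end

/-! Only vertical directions contribute to the Cartan form. Along the horizontal part of `X` the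
projected Levi-Civita connection is metric, so its difference from the dual is trace-free; along the
vertical part the bracket with `δ/δxⁱ` has no horizontal component, so the dual connection merely
differentiates `g`. Hence `η(X) = ½ g^{ij} Xᵛ(g_{ij})`, that is `η = I_k δyᵏ`
(`cartanForm_eq_trace`, `IsLocalFinsler.cartanForm_eq`).

Under `L ↦ e^s L` the quotients `I_k / L` do not change, so `η` changes only through the nonlinear
connection `∂Gⁱ/∂yᵐ`. Writing `s_k = ∂s/∂xᵏ` and raising indices with `g`, the spray gains `(yᵏ s_k)
yⁱ - ½ L² sⁱ` (`spray_expMul`). Differentiating in `yᵐ` and contracting with `I_i / L` kills the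
term containing `I_i yⁱ = 0` and leaves the horizontal one-form `D_m dxᵐ` with `D_m = (s_k yᵏ / L)
I_m + A_{abm} Iᵃ sᵇ - L_{yᵐ} I_i sⁱ` (`cartanForm_expMul_sub`).

So the Cartan forms agree exactly when `D = 0`. This single equation splits in two: since `A` and
`I` annihilate `y` while `L_{yᵐ} yᵐ = L`, contraction with `y` gives `-L ⟨I^*, dσ^*⟩ = 0`, and what
remains is the tensor equation (`conformalEqs_iff`). -/

noncomputable section

namespace Finsler

variable {n : ℕ}

/-! ### Directional derivatives -/

/-- The derivative of `f` in the constant direction `v`. -/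
def dirDeriv (v : P n) (f : P n → ℝ) : P n → ℝ := fun p => fderiv ℝ f p v

theorem pdx_eq_dirDeriv (i : Fin n) (f : P n → ℝ) : pdx i f = dirDeriv (basisVec i, 0) f := rfl

theorem pdy_eq_dirDeriv (i : Fin n) (f : P n → ℝ) : pdy i f = dirDeriv (0, basisVec i) f := rfl

section
variable {Ω : Set (P n)} {f g : P n → ℝ} {p : P n}

theorem contDiffOn_dirDeriv (hΩ : IsOpen Ω) (hf : ContDiffOn ℝ ∞ f Ω) (v : P n) :
    ContDiffOn ℝ ∞ (dirDeriv v f) Ω :=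
  (hf.fderiv_of_isOpen hΩ (by simp)).clm_apply contDiffOn_const

theorem differentiableAt_of_contDiffOn (hΩ : IsOpen Ω) (hf : ContDiffOn ℝ ∞ f Ω) (hp : p ∈ Ω) :
    DifferentiableAt ℝ f p :=
  (hf.contDiffAt (hΩ.mem_nhds hp)).differentiableAt (by simp)

theorem dirDeriv_congr (hΩ : IsOpen Ω) (h : Set.EqOn f g Ω) (v : P n) :
    Set.EqOn (dirDeriv v f) (dirDeriv v g) Ω := fun p hp => by
  have : f =ᶠ[nhds p] g := Filter.eventuallyEq_of_mem (hΩ.mem_nhds hp) h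
  simp only [dirDeriv, this.fderiv_eq]

theorem dirDeriv_add (hf : DifferentiableAt ℝ f p) (hg : DifferentiableAt ℝ g p) (v : P n) :
    dirDeriv v (fun q => f q + g q) p = dirDeriv v f p + dirDeriv v g p := by
  simp [dirDeriv, fderiv_fun_add hf hg]

theorem dirDeriv_sub (hf : DifferentiableAt ℝ f p) (hg : DifferentiableAt ℝ g p) (v : P n) :
    dirDeriv v (fun q => f q - g q) p = dirDeriv v f p - dirDeriv v g p := by
  simp [dirDeriv, fderiv_fun_sub hf hg]

theorem dirDeriv_mul (hf : DifferentiableAt ℝ f p) (hg : DifferentiableAt ℝ g p) (v : P n) :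
    dirDeriv v (fun q => f q * g q) p = f p * dirDeriv v g p + g p * dirDeriv v f p := by
  simp [dirDeriv, fderiv_fun_mul hf hg]

theorem dirDeriv_const_mul (hf : DifferentiableAt ℝ f p) (c : ℝ) (v : P n) :
    dirDeriv v (fun q => c * f q) p = c * dirDeriv v f p := by
  simp [dirDeriv, fderiv_const_mul hf]

theorem dirDeriv_const (c : ℝ) (v p : P n) : dirDeriv v (fun _ => c) p = 0 := by
  simp [dirDeriv]

theorem dirDeriv_sum {ι : Type*} {s : Finset ι} {f : ι → P n → ℝ}
    (hf : ∀ i ∈ s, DifferentiableAt ℝ (f i) p) (v : P n) :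
    dirDeriv v (fun q => ∑ i ∈ s, f i q) p = ∑ i ∈ s, dirDeriv v (f i) p := by
  simp [dirDeriv, fderiv_fun_sum hf]

theorem dirDeriv_comm (hΩ : IsOpen Ω) (hf : ContDiffOn ℝ ∞ f Ω) (hp : p ∈ Ω) (v w : P n) :
    dirDeriv v (dirDeriv w f) p = dirDeriv w (dirDeriv v f) p := by
  have hd : DifferentiableAt ℝ (fderiv ℝ f) p :=
    ((hf.fderiv_of_isOpen (m := ∞) hΩ (by simp)).contDiffAt (hΩ.mem_nhds hp)).differentiableAt
      (by simp)
  have hs : IsSymmSndFDerivAt ℝ f p := (hf.contDiffAt (hΩ.mem_nhds hp)).isSymmSndFDerivAt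
    (by simpa using WithTop.coe_le_coe.2 (OrderTop.le_top (2 : ℕ∞)))
  have key : ∀ a b : P n, dirDeriv a (dirDeriv b f) p = fderiv ℝ (fderiv ℝ f) p a b := fun a b => by
    change fderiv ℝ (fun q => fderiv ℝ f q b) p a = _
    rw [fderiv_clm_apply hd (differentiableAt_const b)]
    simp
  rw [key, key, hs.eq]

/-- The fibre coordinate `yⁱ` is smooth. -/
theorem contDiff_fibreCoord (i : Fin n) : ContDiff ℝ ∞ (fun q : P n => q.2 i) := by
  fun_prop

theorem dirDeriv_fibreCoord (i : Fin n) (v p : P n) :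
    dirDeriv v (fun q : P n => q.2 i) p = v.2 i := by
  have : HasFDerivAt (fun q : P n => q.2 i)
      ((EuclideanSpace.proj (𝕜 := ℝ) i).comp (ContinuousLinearMap.snd ℝ (E n) (E n))) p :=
    ((EuclideanSpace.proj (𝕜 := ℝ) i).comp (ContinuousLinearMap.snd ℝ (E n) (E n))).hasFDerivAt
  simp [dirDeriv, this.fderiv]

theorem basisVec_apply (i j : Fin n) : (basisVec i : E n) j = if j = i then 1 else 0 := by
  simp [basisVec]

theorem sum_smul_basisVec (w : E n) : ∑ i, w i • basisVec i = w := by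
  ext j
  simp [basisVec_apply]

theorem fderiv_vertical (f : P n → ℝ) (p : P n) (w : E n) :
    fderiv ℝ f p (0, w) = ∑ i, w i * pdy i f p := by
  have : ((0, w) : P n) = ∑ i, w i • ((0, basisVec i) : P n) := by
    refine Prod.ext ?_ ?_
    · simp [Prod.fst_sum]
    · simp [Prod.snd_sum, sum_smul_basisVec]
  rw [this, map_sum]
  simp only [map_smul, smul_eq_mul, pdy]

end

/-! ### The Cartan form in natural coordinates -/

section
variable (L : P n → ℝ) (p : P n)

theorem deltaX_fst (i : Fin n) : (deltaX L i p).1 = basisVec i := rfl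

theorem deltaX_snd_apply (i k : Fin n) : (deltaX L i p).2 k = -pdy i (spray L k) p := by
  simp [deltaX, basisVec_apply]

theorem dyForm_deltaX (i k : Fin n) : dyForm L k p (deltaX L i p) = 0 := by
  simp [dyForm, deltaX_snd_apply, deltaX_fst, basisVec_apply]

theorem innerFn_deltaX (i j : Fin n) :
    innerFn L (deltaX L i) (deltaX L j) = fun p => fundMatrix L p i j := by
  funext p
  simp [innerFn, sasaki, dyForm_deltaX, deltaX_fst, basisVec_apply]

theorem sasaki_sum_smul_deltaX (a b : Fin n → ℝ) :
    sasaki L p (∑ i, a i • deltaX L i p) (∑ j, b j • deltaX L j p)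
      = ∑ i, ∑ j, fundMatrix L p i j * a i * b j := by
  have h0 : ∀ (a : Fin n → ℝ) k, dyForm L k p (∑ i, a i • deltaX L i p) = 0 := fun a k => by
    simp [dyForm, Prod.snd_sum, Prod.fst_sum, deltaX_snd_apply, deltaX_fst, basisVec_apply,
      mul_comm]
  have h1 : ∀ (a : Fin n → ℝ), (∑ i, a i • deltaX L i p).1 = ∑ i, a i • basisVec i := fun a => by
    simp [Prod.fst_sum, deltaX_fst]
  simp [sasaki, h0, h1, basisVec_apply]

theorem vert_fst (X : P n → P n) : (vert L X p).1 = 0 := by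
  simp [vert, horiz, Prod.fst_sum, deltaX_fst, sum_smul_basisVec]

theorem vert_snd_apply (X : P n → P n) (k : Fin n) :
    (vert L X p).2 k = (X p).2 k + ∑ i, (X p).1 i * pdy i (spray L k) p := by
  simp [vert, horiz, Prod.snd_sum, deltaX_snd_apply]

/-- No differentiability is needed, because `fderiv` is zero by default where it fails. The trace
formula for the Cartan form therefore holds for arbitrary fields `X`. -/
theorem fderiv_apply_fst_eq_zero {Y : P n → P n} {c : E n} (hY : ∀ q, (Y q).1 = c) (v : P n) :
    (fderiv ℝ Y p v).1 = 0 := by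
  by_cases h : DifferentiableAt ℝ Y p
  · have h1 : HasFDerivAt (fun q => (Y q).1)
        ((ContinuousLinearMap.fst ℝ (E n) (E n)).comp (fderiv ℝ Y p)) p :=
      (ContinuousLinearMap.fst ℝ (E n) (E n)).hasFDerivAt.comp p h.hasFDerivAt
    have h2 : HasFDerivAt (fun q => (Y q).1) (0 : P n →L[ℝ] E n) p := by
      simp only [hY]; exact hasFDerivAt_const c p
    simpa using congrArg (fun T : P n →L[ℝ] E n => T v) (h1.unique h2)
  · simp [fderiv_zero_of_not_differentiableAt h]

/-- Both fields have constant base components (zero and `∂/∂xⁱ`), so their bracket is vertical and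
its projection vanishes. -/
theorem bott_deltaX (X : P n → P n) (i : Fin n) :
    bott L X (deltaX L i) p = projLC L (horiz L X) (deltaX L i) p := by
  have h : (VectorField.lieBracket ℝ (vert L X) (deltaX L i) p).1 = 0 := by
    simp [VectorField.lieBracket, fderiv_apply_fst_eq_zero p (fun q => vert_fst L q X),
      fderiv_apply_fst_eq_zero p (fun q => deltaX_fst L q i)]
  simp [bott, horiz, h]

theorem sasaki_neg_left (ξ ζ : P n) : sasaki L p (-ξ) ζ = -sasaki L p ξ ζ := by
  have h : ∀ k, dyForm L k p (-ξ) = -dyForm L k p ξ := fun k => by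
    simp [dyForm]; ring
  simp [sasaki, h]; ring

/-- Metric compatibility of the Levi-Civita connection. The two inner products on the right are kept
apart, so symmetry of `g` is not required. -/
theorem koszul_add_koszul_swap (X U V : P n → P n) :
    koszul L X U V p + koszul L X V U p
      = 1 / 2 * (along X (innerFn L U V) p + along X (innerFn L V U) p) := by
  have h : innerFn L (VectorField.lieBracket ℝ V U) X p
      = -innerFn L (VectorField.lieBracket ℝ U V) X p := by
    have hsw : VectorField.lieBracket ℝ V U p = -VectorField.lieBracket ℝ U V p := by
      simp [VectorField.lieBracket]
    rw [innerFn, hsw, sasaki_neg_left, innerFn]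
  simp only [koszul, h]; ring

theorem along_sub_along_horiz (X : P n → P n) (f : P n → ℝ) :
    along X f p - along (horiz L X) f p = ∑ k, (vert L X p).2 k * pdy k f p := by
  have h : vert L X p = (0, (vert L X p).2) := Prod.ext (vert_fst L p X) rfl
  rw [← fderiv_vertical, ← h, vert, map_sub, along, along]

variable {L p}

/-- Pointwise algebra: with `K i j = ⟨∇_{hX} δ/δxⁱ, δ/δxʲ⟩`, the traces of the dual and of the Bott
connection are `g^{ij}(X(g_{ij}) - K i j)` and `g^{ij} K i j`. Compatibility gives `2 g^{ij} K i j =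
g^{ij} (hX)(g_{ij})`, and `X - hX` is the vertical part. -/
theorem cartanForm_eq_trace (hs : (fundInv L p).IsSymm)
    (hi : fundInv L p * fundMatrix L p = 1) (X : P n → P n) :
    cartanForm L X p = 1 / 2 * ∑ i, ∑ j, fundInv L p i j *
      ∑ k, (vert L X p).2 k * pdy k (fun q => fundMatrix L q i j) p := by
  set K : Fin n → Fin n → ℝ := fun i j => koszul L (horiz L X) (deltaX L i) (deltaX L j) p with hK
  have hsy : ∀ i j, fundInv L p i j = fundInv L p j i := fun i j => (hs.apply j i)
  have hb : ∀ i, bott L X (deltaX L i) p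
      = ∑ d, (∑ c, fundInv L p c d * K i c) • deltaX L d p := fun i => by
    rw [bott_deltaX, projLC, Finset.sum_comm]
    simp [Finset.sum_smul, hK]
  have hin : ∀ i j, innerFn L (bott L X (deltaX L i)) (deltaX L j) p = K i j := fun i j => by
    have hj : deltaX L j p = ∑ d, (if d = j then (1 : ℝ) else 0) • deltaX L d p := by simp
    rw [innerFn, hb, hj, sasaki_sum_smul_deltaX]
    have : ∀ c, ∑ d, fundInv L p c d * fundMatrix L p d j = if c = j then 1 else 0 := fun c => by
      rw [← Matrix.mul_apply, hi, Matrix.one_apply]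
    calc _ = ∑ c, (∑ d, fundInv L p c d * fundMatrix L p d j) * K i c := by
          simp only [mul_ite, mul_one, mul_zero, Finset.sum_ite_eq',
            Finset.mem_univ, if_true, Finset.mul_sum, Finset.sum_mul]
          rw [Finset.sum_comm]
          exact Finset.sum_congr rfl fun _ _ => Finset.sum_congr rfl fun _ _ => by ring
      _ = _ := by simp [this]
  have hbt : ∀ i, (bott L X (deltaX L i) p).1 i = ∑ j, fundInv L p i j * K i j := fun i => by
    rw [hb]
    simp [Prod.fst_sum, deltaX_fst, basisVec_apply, hsy _ i]
  have hdt : ∀ j, (bottDual L X (deltaX L j) p).1 j = ∑ i, fundInv L p i j *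
      (along X (fun q => fundMatrix L q i j) p - K i j) := fun j => by
    simp only [bottDual, hin, innerFn_deltaX]
    simp [Prod.fst_sum, deltaX_fst, basisVec_apply]
  have hKK : ∀ i j, K i j + K j i = 1 / 2 * (along (horiz L X) (fun q => fundMatrix L q i j) p
      + along (horiz L X) (fun q => fundMatrix L q j i) p) := fun i j => by
    rw [← innerFn_deltaX, ← innerFn_deltaX]; exact koszul_add_koszul_swap L p _ _ _
  have hswap : ∀ T : Fin n → Fin n → ℝ,
      ∑ i, ∑ j, fundInv L p i j * T j i = ∑ i, ∑ j, fundInv L p i j * T i j := fun T => by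
    rw [Finset.sum_comm]
    exact Finset.sum_congr rfl fun i _ => Finset.sum_congr rfl fun j _ => by rw [hsy]
  -- `K` need not be symmetric, but the symmetric `g^{ij}` sees only its symmetric part, which `hKK`
  -- determines.
  have hKs : ∑ i, ∑ j, fundInv L p i j * K i j
      = 1 / 2 * ∑ i, ∑ j, fundInv L p i j * along (horiz L X) (fun q => fundMatrix L q i j) p := by
    have h1 : ∑ i, ∑ j, fundInv L p i j * (K i j + K j i)
        = ∑ i, ∑ j, fundInv L p i j *
          (1 / 2 * (along (horiz L X) (fun q => fundMatrix L q i j) p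
            + along (horiz L X) (fun q => fundMatrix L q j i) p)) := by simp only [hKK]
    have e1 : ∀ T S : Fin n → Fin n → ℝ, ∑ i, ∑ j, fundInv L p i j * (T i j + S i j)
        = ∑ i, ∑ j, fundInv L p i j * T i j + ∑ i, ∑ j, fundInv L p i j * S i j := fun T S => by
      simp [mul_add, Finset.sum_add_distrib]
    simp only [mul_left_comm _ (1 / 2 : ℝ), ← Finset.mul_sum] at h1
    rw [e1 K (fun i j => K j i), hswap K, e1, hswap fun i j =>
      along (horiz L X) (fun q => fundMatrix L q i j) p] at h1
    linarith
  have hc : cartanForm L X p = 1 / 2 *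
      (∑ j, (bottDual L X (deltaX L j) p).1 j - ∑ j, (bott L X (deltaX L j) p).1 j) := by
    simp [cartanForm, cartanEndo, ← Finset.mul_sum, Finset.sum_sub_distrib]
  rw [hc]
  simp only [hbt, hdt]
  rw [Finset.sum_comm]
  simp only [← along_sub_along_horiz, mul_sub, Finset.sum_sub_distrib]
  rw [hKs]
  ring

end

/-! ### Finsler functions on open sets of the slit tangent bundle -/

/-- `L` is the coordinate expression of a Finsler function on the open set `Ω`. -/
structure IsLocalFinsler (L : P n → ℝ) (Ω : Set (P n)) : Prop where
  isOpen : IsOpen Ω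
  smooth : ContDiffOn ℝ ∞ L Ω
  pos : ∀ p ∈ Ω, 0 < L p
  euler : ∀ p ∈ Ω, fderiv ℝ L p (0, p.2) = L p
  posDef : ∀ p ∈ Ω, (fundMatrix L p).PosDef

theorem contDiffOn_matrix_det {m : ℕ} {Ω : Set (P n)} {A : P n → Matrix (Fin m) (Fin m) ℝ}
    (hA : ∀ i j, ContDiffOn ℝ ∞ (fun q => A q i j) Ω) :
    ContDiffOn ℝ ∞ (fun q => (A q).det) Ω := by
  simp only [Matrix.det_apply]
  exact ContDiffOn.sum fun τ _ => (contDiffOn_prod fun i _ => hA _ _).const_smul _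

theorem contDiffOn_matrix_inv {m : ℕ} {Ω : Set (P n)} {A : P n → Matrix (Fin m) (Fin m) ℝ}
    (hA : ∀ i j, ContDiffOn ℝ ∞ (fun q => A q i j) Ω) (h0 : ∀ q ∈ Ω, (A q).det ≠ 0)
    (i j : Fin m) : ContDiffOn ℝ ∞ (fun q => (A q)⁻¹ i j) Ω := by
  simp only [Matrix.inv_def, Matrix.smul_apply, Matrix.adjugate_apply, Ring.inverse_eq_inv',
    smul_eq_mul]
  refine ((contDiffOn_matrix_det hA).inv h0).mul (contDiffOn_matrix_det fun a b => ?_)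
  -- In the adjugate, row `j` is replaced by a constant basis vector; the other rows are those of
  -- `A`.
  by_cases h : a = j
  · subst h
    simpa using contDiffOn_const
  · simpa [Matrix.updateRow_ne h] using hA a b

/-- The components `g^{ij} A_{ijk}` of the usual Cartan form. -/
def meanCartan (L : P n → ℝ) (k : Fin n) (p : P n) : ℝ :=
  ∑ i, ∑ j, fundInv L p i j * cartanCoeff L i j k p

/-- The extra term `f j` is what lowers the degree of homogeneity by one each time an Euler relation
is differentiated in `y`. -/
theorem dirDeriv_sum_fibreCoord_mul {f : Fin n → P n → ℝ} {p : P n}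
    (hf : ∀ i, DifferentiableAt ℝ (f i) p) (j : Fin n) :
    pdy j (fun q => ∑ i, q.2 i * f i q) p = ∑ i, p.2 i * pdy j (f i) p + f j p := by
  have hy : ∀ i, DifferentiableAt ℝ (fun q : P n => q.2 i) p := fun i =>
    (contDiff_fibreCoord i).differentiable (by simp) p
  rw [pdy_eq_dirDeriv, dirDeriv_sum fun i _ => (hy i).fun_mul (hf i)]
  simp only [dirDeriv_mul (hy _) (hf _), dirDeriv_fibreCoord, Finset.sum_add_distrib,
    basisVec_apply]
  simp [pdy_eq_dirDeriv]

namespace IsLocalFinsler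

variable {L : P n → ℝ} {Ω : Set (P n)} {p : P n}

theorem ne_zero (h : IsLocalFinsler L Ω) (hp : p ∈ Ω) : L p ≠ 0 := (h.pos p hp).ne'

theorem contDiffOn_sq (h : IsLocalFinsler L Ω) : ContDiffOn ℝ ∞ (sq L) Ω := h.smooth.pow 2

theorem contDiffOn_pdy_sq (h : IsLocalFinsler L Ω) (i : Fin n) :
    ContDiffOn ℝ ∞ (pdy i (sq L)) Ω := contDiffOn_dirDeriv h.isOpen h.contDiffOn_sq _

theorem contDiffOn_pdy_pdy_sq (h : IsLocalFinsler L Ω) (i j : Fin n) :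
    ContDiffOn ℝ ∞ (pdy j (pdy i (sq L))) Ω :=
  contDiffOn_dirDeriv h.isOpen (h.contDiffOn_pdy_sq i) _

theorem contDiffOn_fundMatrix (h : IsLocalFinsler L Ω) (i j : Fin n) :
    ContDiffOn ℝ ∞ (fun q => fundMatrix L q i j) Ω :=
  contDiffOn_const.mul (h.contDiffOn_pdy_pdy_sq i j)

theorem contDiffOn_fundInv (h : IsLocalFinsler L Ω) (i j : Fin n) :
    ContDiffOn ℝ ∞ (fun q => fundInv L q i j) Ω :=
  contDiffOn_matrix_inv h.contDiffOn_fundMatrix (fun q hq => (h.posDef q hq).det_pos.ne') i j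

theorem contDiffOn_spray (h : IsLocalFinsler L Ω) (i : Fin n) :
    ContDiffOn ℝ ∞ (spray L i) Ω :=
  contDiffOn_const.mul <| ContDiffOn.sum fun j _ => (h.contDiffOn_fundInv i j).mul <|
    (ContDiffOn.sum fun k _ => (contDiffOn_dirDeriv h.isOpen (h.contDiffOn_pdy_sq j) _).mul
      (contDiff_fibreCoord k).contDiffOn).sub (contDiffOn_dirDeriv h.isOpen h.contDiffOn_sq _)

theorem fundMatrix_symm (h : IsLocalFinsler L Ω) (hp : p ∈ Ω) (i j : Fin n) :
    fundMatrix L p i j = fundMatrix L p j i := by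
  simp only [fundMatrix, Matrix.of_apply, pdy_eq_dirDeriv]
  rw [dirDeriv_comm h.isOpen h.contDiffOn_sq hp]

theorem fundInv_isSymm (h : IsLocalFinsler L Ω) (hp : p ∈ Ω) : (fundInv L p).IsSymm := by
  have : (fundMatrix L p).IsSymm := Matrix.IsSymm.ext fun i j => h.fundMatrix_symm hp j i
  rw [Matrix.IsSymm, fundInv, Matrix.transpose_nonsing_inv, this.eq]

theorem fundInv_symm (h : IsLocalFinsler L Ω) (hp : p ∈ Ω) (i j : Fin n) :
    fundInv L p i j = fundInv L p j i := (h.fundInv_isSymm hp).apply j i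

theorem isUnit_det (h : IsLocalFinsler L Ω) (hp : p ∈ Ω) : IsUnit (fundMatrix L p).det :=
  (h.posDef p hp).det_pos.ne'.isUnit

theorem fundInv_mul (h : IsLocalFinsler L Ω) (hp : p ∈ Ω) :
    fundInv L p * fundMatrix L p = 1 := Matrix.nonsing_inv_mul _ (h.isUnit_det hp)

theorem mul_fundInv (h : IsLocalFinsler L Ω) (hp : p ∈ Ω) :
    fundMatrix L p * fundInv L p = 1 := Matrix.mul_nonsing_inv _ (h.isUnit_det hp)

/-! ### Euler relations for `L²` and its vertical derivatives. -/

theorem pdy_sq (h : IsLocalFinsler L Ω) (hp : p ∈ Ω) (i : Fin n) :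
    pdy i (sq L) p = 2 * L p * pdy i L p := by
  have hd := differentiableAt_of_contDiffOn h.isOpen h.smooth hp
  have : sq L = fun q => L q * L q := by funext q; simp [sq, pow_two]
  rw [this, pdy_eq_dirDeriv, dirDeriv_mul hd hd, pdy_eq_dirDeriv]
  ring

theorem sum_mul_pdy (h : IsLocalFinsler L Ω) (hp : p ∈ Ω) : ∑ i, p.2 i * pdy i L p = L p := by
  rw [← fderiv_vertical, h.euler p hp]

theorem sum_mul_pdy_sq (h : IsLocalFinsler L Ω) (hp : p ∈ Ω) :
    ∑ i, p.2 i * pdy i (sq L) p = 2 * sq L p := by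
  simp only [h.pdy_sq hp, mul_left_comm _ (2 * L p), ← Finset.mul_sum, h.sum_mul_pdy hp, sq]
  ring

theorem sum_mul_pdy_pdy_sq (h : IsLocalFinsler L Ω) (hp : p ∈ Ω) (j : Fin n) :
    ∑ i, p.2 i * pdy j (pdy i (sq L)) p = pdy j (sq L) p := by
  have h1 := dirDeriv_congr h.isOpen (fun q hq => h.sum_mul_pdy_sq (p := q) hq)
    (0, basisVec j) hp
  rw [← pdy_eq_dirDeriv, dirDeriv_sum_fibreCoord_mul fun i =>
    differentiableAt_of_contDiffOn h.isOpen (h.contDiffOn_pdy_sq i) hp,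
    dirDeriv_const_mul (differentiableAt_of_contDiffOn h.isOpen h.contDiffOn_sq hp),
    ← pdy_eq_dirDeriv] at h1
  linarith

theorem sum_fundMatrix_mul (h : IsLocalFinsler L Ω) (hp : p ∈ Ω) (j : Fin n) :
    pdy j (sq L) p = 2 * ∑ i, fundMatrix L p j i * p.2 i := by
  rw [← h.sum_mul_pdy_pdy_sq hp, Finset.mul_sum]
  refine Finset.sum_congr rfl fun i _ => ?_
  rw [h.fundMatrix_symm hp j i]
  simp only [fundMatrix, Matrix.of_apply]
  ring

theorem sum_mul_pdy_pdy_pdy_sq (h : IsLocalFinsler L Ω) (hp : p ∈ Ω) (j k : Fin n) :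
    ∑ i, p.2 i * pdy k (pdy j (pdy i (sq L))) p = 0 := by
  have h1 := dirDeriv_congr h.isOpen (fun q hq => h.sum_mul_pdy_pdy_sq (p := q) hq j)
    (0, basisVec k) hp
  rw [← pdy_eq_dirDeriv, dirDeriv_sum_fibreCoord_mul fun i =>
    differentiableAt_of_contDiffOn h.isOpen (h.contDiffOn_pdy_pdy_sq i j) hp] at h1
  have h2 : pdy j (pdy k (sq L)) p = dirDeriv (0, basisVec k) (pdy j (sq L)) p :=
    dirDeriv_comm h.isOpen h.contDiffOn_sq hp _ _
  linarith

theorem cartanCoeff_swap_left (h : IsLocalFinsler L Ω) (hp : p ∈ Ω) (i j k : Fin n) :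
    cartanCoeff L i j k p = cartanCoeff L j i k p := by
  have := dirDeriv_congr h.isOpen (fun q hq => dirDeriv_comm h.isOpen h.contDiffOn_sq (p := q) hq
    (0, basisVec j) (0, basisVec i)) (0, basisVec k) hp
  simp only [cartanCoeff, pdy_eq_dirDeriv, this]

theorem cartanCoeff_swap_right (h : IsLocalFinsler L Ω) (hp : p ∈ Ω) (i j k : Fin n) :
    cartanCoeff L i j k p = cartanCoeff L i k j p := by
  have := dirDeriv_comm h.isOpen (h.contDiffOn_pdy_sq i) hp (0, basisVec k) (0, basisVec j)
  simp only [cartanCoeff, pdy_eq_dirDeriv] at this ⊢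
  rw [this]

theorem sum_cartanCoeff_mul (h : IsLocalFinsler L Ω) (hp : p ∈ Ω) (i j : Fin n) :
    ∑ k, cartanCoeff L i j k p * p.2 k = 0 := by
  have h1 : ∀ k, cartanCoeff L i j k p = cartanCoeff L k i j p := fun k => by
    rw [h.cartanCoeff_swap_right hp, h.cartanCoeff_swap_left hp]
  have h2 := h.sum_mul_pdy_pdy_pdy_sq hp i j
  calc _ = 1 / 4 * L p * ∑ k, p.2 k * pdy j (pdy i (pdy k (sq L))) p := by
        rw [Finset.mul_sum]
        refine Finset.sum_congr rfl fun k _ => ?_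
        rw [h1, cartanCoeff]; ring
    _ = 0 := by rw [h2, mul_zero]

theorem sum_meanCartan_mul (h : IsLocalFinsler L Ω) (hp : p ∈ Ω) :
    ∑ k, meanCartan L k p * p.2 k = 0 := by
  simp only [meanCartan, Finset.sum_mul]
  rw [Finset.sum_comm]
  refine Finset.sum_eq_zero fun i _ => ?_
  rw [Finset.sum_comm]
  refine Finset.sum_eq_zero fun j _ => ?_
  simp only [mul_assoc, ← Finset.mul_sum, h.sum_cartanCoeff_mul hp, mul_zero]

/-! ### Vertical derivatives of the fundamental tensor and the formula `η = I_k δyᵏ`. -/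

theorem pdy_fundMatrix (h : IsLocalFinsler L Ω) (hp : p ∈ Ω) (i j k : Fin n) :
    pdy k (fun q => fundMatrix L q i j) p = 2 / L p * cartanCoeff L i j k p := by
  have h0 := h.ne_zero hp
  have := dirDeriv_const_mul (differentiableAt_of_contDiffOn h.isOpen
    (h.contDiffOn_pdy_pdy_sq i j) hp) (1 / 2) (0, basisVec k)
  simp only [fundMatrix, Matrix.of_apply]
  rw [pdy_eq_dirDeriv, this, cartanCoeff, ← pdy_eq_dirDeriv]
  field_simp
  ring

theorem cartanForm_eq (h : IsLocalFinsler L Ω) (hp : p ∈ Ω) (X : P n → P n) :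
    cartanForm L X p = ∑ k, meanCartan L k p / L p * (vert L X p).2 k := by
  rw [cartanForm_eq_trace (h.fundInv_isSymm hp) (h.fundInv_mul hp)]
  simp only [h.pdy_fundMatrix hp, meanCartan, Finset.mul_sum, Finset.sum_div, Finset.sum_mul]
  rw [Finset.sum_comm_cycle]
  refine Finset.sum_congr rfl fun k _ => Finset.sum_congr rfl fun i _ =>
    Finset.sum_congr rfl fun j _ => ?_
  ring

/-- Differentiate `g⁻¹ g = 1` and multiply by `g⁻¹` on the right. -/
theorem pdy_fundInv (h : IsLocalFinsler L Ω) (hp : p ∈ Ω) (i j m : Fin n) :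
    pdy m (fun q => fundInv L q i j) p
      = -(2 / L p) * ∑ a, ∑ b, fundInv L p i a * cartanCoeff L a b m p * fundInv L p b j := by
  set D : Matrix (Fin n) (Fin n) ℝ := Matrix.of fun i j => pdy m (fun q => fundInv L q i j) p
    with hD
  set C : Matrix (Fin n) (Fin n) ℝ := Matrix.of fun i j => cartanCoeff L i j m p with hC
  have hdi : ∀ i j, DifferentiableAt ℝ (fun q => fundInv L q i j) p := fun i j =>
    differentiableAt_of_contDiffOn h.isOpen (h.contDiffOn_fundInv i j) hp
  have hdm : ∀ i j, DifferentiableAt ℝ (fun q => fundMatrix L q i j) p := fun i j =>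
    differentiableAt_of_contDiffOn h.isOpen (h.contDiffOn_fundMatrix i j) hp
  have key : D * fundMatrix L p + (2 / L p) • (fundInv L p * C) = 0 := by
    ext a b
    have h1 : Set.EqOn (fun q => ∑ c, fundInv L q a c * fundMatrix L q c b)
        (fun _ => (1 : Matrix (Fin n) (Fin n) ℝ) a b) Ω := fun q hq => by
      simp only [← Matrix.mul_apply, h.fundInv_mul hq]
    have h2 := dirDeriv_congr h.isOpen h1 (0, basisVec m) hp
    rw [dirDeriv_const, dirDeriv_sum fun c _ => (hdi a c).fun_mul (hdm c b)] at h2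
    simp only [dirDeriv_mul (hdi _ _) (hdm _ _), ← pdy_eq_dirDeriv, h.pdy_fundMatrix hp] at h2
    simp only [Matrix.add_apply, Matrix.smul_apply, Matrix.mul_apply, hD, hC, Matrix.of_apply,
      smul_eq_mul, Matrix.zero_apply, Finset.mul_sum, ← Finset.sum_add_distrib]
    rw [← h2]
    exact Finset.sum_congr rfl fun c _ => by ring
  have hDeq : D = -((2 / L p) • (fundInv L p * C * fundInv L p)) := by
    have h1 := congrArg (· * fundInv L p) key
    simp only [Matrix.add_mul, Matrix.mul_assoc, h.mul_fundInv hp, Matrix.zero_mul, Matrix.mul_one,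
      Matrix.smul_mul] at h1
    rw [Matrix.mul_assoc]
    exact eq_neg_of_add_eq_zero_left h1
  have := congrFun (congrFun hDeq i) j
  simp only [hD, Matrix.of_apply] at this
  rw [this]
  simp only [Matrix.neg_apply, Matrix.smul_apply, Matrix.mul_apply, hC, Matrix.of_apply,
    smul_eq_mul, Finset.sum_mul]
  rw [Finset.sum_comm, neg_mul]

end IsLocalFinsler

/-! ### Conformal change -/

/-- `L` is a local Finsler function and `s` a smooth function of the base point. -/
structure IsConformalPair (L s : P n → ℝ) (Ω : Set (P n)) : Prop where
  finsler : IsLocalFinsler L Ω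
  smooth : ContDiffOn ℝ ∞ s Ω
  basic : ∀ p ∈ Ω, ∀ w : E n, fderiv ℝ s p (0, w) = 0

/-- The function `e^s L`. -/
def expMul (s L : P n → ℝ) : P n → ℝ := fun p => Real.exp (s p) * L p

/-- The vector `g^{ij} α_j`. -/
def raise (L : P n → ℝ) (p : P n) (α : Fin n → ℝ) (i : Fin n) : ℝ := ∑ j, fundInv L p i j * α j

/-- The components, in a conformal change by `e^s`, of `G(s) I + A(I^*, ds^*) - ⟨I^*, ds^*⟩ dL`. -/
def conformalDefect (L s : P n → ℝ) (m : Fin n) (p : P n) : ℝ :=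
  (∑ k, pdx k s p * p.2 k) / L p * meanCartan L m p
    + ∑ a, ∑ b, cartanCoeff L a b m p * raise L p (fun i => meanCartan L i p) a
        * raise L p (fun j => pdx j s p) b
    - pdy m L p * ∑ i, meanCartan L i p * raise L p (fun j => pdx j s p) i

namespace IsConformalPair

variable {L s : P n → ℝ} {Ω : Set (P n)} {p : P n}

theorem differentiableAt (h : IsConformalPair L s Ω) (hp : p ∈ Ω) : DifferentiableAt ℝ s p :=
  differentiableAt_of_contDiffOn h.finsler.isOpen h.smooth hp

theorem dirDeriv_exp_pow_mul (h : IsConformalPair L s Ω) (hp : p ∈ Ω) (m : ℕ) {f : P n → ℝ}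
    (hf : DifferentiableAt ℝ f p) (v : P n) :
    dirDeriv v (fun q => Real.exp (s q) ^ m * f q) p
      = Real.exp (s p) ^ m * (dirDeriv v f p + m * fderiv ℝ s p v * f p) := by
  have hs := (h.differentiableAt hp).hasFDerivAt
  have he : HasFDerivAt (fun q => Real.exp (s q) ^ m)
      ((m * Real.exp (s p) ^ m) • fderiv ℝ s p) p := by
    -- The power rule involves the truncated exponent `m - 1`, so `m = 0` is separated.
    rcases m with _ | m
    · simpa using hasFDerivAt_const (1 : ℝ) p
    · refine ((((Real.hasDerivAt_exp (s p)).fun_pow (m + 1))).comp_hasFDerivAt p hs).congr_fderiv ?_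
      simp [pow_succ, mul_assoc]
  rw [dirDeriv_mul he.differentiableAt hf]
  simp only [dirDeriv, he.fderiv]
  simp
  ring

theorem pdy_exp_pow_mul (h : IsConformalPair L s Ω) (hp : p ∈ Ω) (m : ℕ) {f : P n → ℝ}
    (hf : DifferentiableAt ℝ f p) (i : Fin n) :
    pdy i (fun q => Real.exp (s q) ^ m * f q) p = Real.exp (s p) ^ m * pdy i f p := by
  rw [pdy_eq_dirDeriv, h.dirDeriv_exp_pow_mul hp m hf, h.basic p hp, pdy_eq_dirDeriv]
  ring

/-! ### Conformal weights of the vertical data. -/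

theorem sq_expMul : sq (expMul s L) = fun q => Real.exp (s q) ^ 2 * sq L q := by
  funext q; simp [sq, expMul, mul_pow]

theorem pdy_sq_expMul (h : IsConformalPair L s Ω) (i : Fin n) :
    Set.EqOn (pdy i (sq (expMul s L))) (fun q => Real.exp (s q) ^ 2 * pdy i (sq L) q) Ω :=
  fun q hq => by
    rw [sq_expMul]
    exact h.pdy_exp_pow_mul hq 2
      (differentiableAt_of_contDiffOn h.finsler.isOpen h.finsler.contDiffOn_sq hq) i

theorem pdy_pdy_sq_expMul (h : IsConformalPair L s Ω) (i j : Fin n) :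
    Set.EqOn (pdy j (pdy i (sq (expMul s L))))
      (fun q => Real.exp (s q) ^ 2 * pdy j (pdy i (sq L)) q) Ω :=
  fun _ hq => (dirDeriv_congr h.finsler.isOpen (h.pdy_sq_expMul i) _ hq).trans <|
    h.pdy_exp_pow_mul hq 2
      (differentiableAt_of_contDiffOn h.finsler.isOpen (h.finsler.contDiffOn_pdy_sq i) hq) j

theorem cartanCoeff_expMul (h : IsConformalPair L s Ω) (hp : p ∈ Ω) (i j k : Fin n) :
    cartanCoeff (expMul s L) i j k p = Real.exp (s p) ^ 3 * cartanCoeff L i j k p := by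
  have h1 : pdy k (pdy j (pdy i (sq (expMul s L)))) p
      = Real.exp (s p) ^ 2 * pdy k (pdy j (pdy i (sq L))) p :=
    (dirDeriv_congr h.finsler.isOpen (h.pdy_pdy_sq_expMul i j) _ hp).trans <|
      h.pdy_exp_pow_mul hp 2 (differentiableAt_of_contDiffOn h.finsler.isOpen
        (h.finsler.contDiffOn_pdy_pdy_sq i j) hp) k
  rw [cartanCoeff, h1, cartanCoeff, expMul]
  ring

theorem fundMatrix_expMul (h : IsConformalPair L s Ω) (hp : p ∈ Ω) :
    fundMatrix (expMul s L) p = Real.exp (s p) ^ 2 • fundMatrix L p := by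
  ext i j
  simp only [fundMatrix, Matrix.of_apply, Matrix.smul_apply, smul_eq_mul,
    h.pdy_pdy_sq_expMul i j hp]
  ring

theorem fundInv_expMul (h : IsConformalPair L s Ω) (hp : p ∈ Ω) (i j : Fin n) :
    fundInv (expMul s L) p i j = (Real.exp (s p) ^ 2)⁻¹ * fundInv L p i j := by
  have h0 : Real.exp (s p) ^ 2 ≠ 0 := by positivity
  have : fundInv (expMul s L) p = (Real.exp (s p) ^ 2)⁻¹ • fundInv L p := by
    rw [fundInv, h.fundMatrix_expMul hp]
    apply Matrix.inv_eq_left_inv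
    rw [Matrix.smul_mul, Matrix.mul_smul, h.finsler.fundInv_mul hp, smul_smul,
      inv_mul_cancel₀ h0, one_smul]
  rw [this, Matrix.smul_apply, smul_eq_mul]

theorem isLocalFinsler_expMul (h : IsConformalPair L s Ω) : IsLocalFinsler (expMul s L) Ω where
  isOpen := h.finsler.isOpen
  smooth := h.smooth.exp.mul h.finsler.smooth
  pos p hp := mul_pos (Real.exp_pos _) (h.finsler.pos p hp)
  euler p hp := by
    calc fderiv ℝ (expMul s L) p (0, p.2)
        = dirDeriv (0, p.2) (fun q => Real.exp (s q) ^ 1 * L q) p := by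
          simp only [pow_one]; rfl
      _ = expMul s L p := by
          rw [h.dirDeriv_exp_pow_mul hp 1
            (differentiableAt_of_contDiffOn h.finsler.isOpen h.finsler.smooth hp),
            h.basic p hp, dirDeriv, h.finsler.euler p hp, expMul]
          ring
  posDef p hp := by
    rw [h.fundMatrix_expMul hp]
    exact (h.finsler.posDef p hp).smul (by positivity)

/-- The weights cancel: `g^{ij}` has weight `-2`, `A` has weight `3` and `L` has weight `1`. -/
theorem meanCartan_expMul (h : IsConformalPair L s Ω) (hp : p ∈ Ω) (k : Fin n) :
    meanCartan (expMul s L) k p / expMul s L p = meanCartan L k p / L p := by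
  have h0 := h.finsler.ne_zero hp
  have h1 : meanCartan (expMul s L) k p = Real.exp (s p) * meanCartan L k p := by
    simp only [meanCartan, h.fundInv_expMul hp, h.cartanCoeff_expMul hp, Finset.mul_sum]
    refine Finset.sum_congr rfl fun i _ => Finset.sum_congr rfl fun j _ => ?_
    field_simp
  rw [h1, expMul]
  field_simp

/-- The factors `e^{±2s}` cancel. The new terms come from `∂/∂x` hitting the exponential, and
`g^{ij} [L²]_{yʲ} = 2 yⁱ` turns the first of them into a multiple of `yⁱ`. -/
theorem spray_expMul (h : IsConformalPair L s Ω) (i : Fin n) :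
    Set.EqOn (spray (expMul s L) i) (fun q => spray L i q + ((∑ k, q.2 k * pdx k s q) * q.2 i
      - 1 / 2 * (sq L q * ∑ j, fundInv L q i j * pdx j s q))) Ω := fun q hq => by
  have hsqd := differentiableAt_of_contDiffOn h.finsler.isOpen h.finsler.contDiffOn_sq hq
  have h1 : ∀ j k, pdx k (pdy j (sq (expMul s L))) q
      = Real.exp (s q) ^ 2 * (pdx k (pdy j (sq L)) q + 2 * pdx k s q * pdy j (sq L) q) :=
    fun j k => (dirDeriv_congr h.finsler.isOpen (h.pdy_sq_expMul j) _ hq).trans <|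
      h.dirDeriv_exp_pow_mul hq 2 (differentiableAt_of_contDiffOn h.finsler.isOpen
        (h.finsler.contDiffOn_pdy_sq j) hq) _
  have h2 : ∀ j, pdx j (sq (expMul s L)) q
      = Real.exp (s q) ^ 2 * (pdx j (sq L) q + 2 * pdx j s q * sq L q) := fun j => by
    rw [sq_expMul]
    exact h.dirDeriv_exp_pow_mul hq 2 hsqd _
  have h3 : ∑ j, fundInv L q i j * pdy j (sq L) q = 2 * q.2 i := by
    have hinv : ∀ k, ∑ j, fundInv L q i j * fundMatrix L q j k = if i = k then 1 else 0 :=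
      fun k => by rw [← Matrix.mul_apply, h.finsler.fundInv_mul hq, Matrix.one_apply]
    calc _ = 2 * ∑ k, (∑ j, fundInv L q i j * fundMatrix L q j k) * q.2 k := by
          simp only [h.finsler.sum_fundMatrix_mul hq, Finset.mul_sum, Finset.sum_mul]
          rw [Finset.sum_comm]
          exact Finset.sum_congr rfl fun _ _ => Finset.sum_congr rfl fun _ _ => by ring
      _ = _ := by simp [hinv]
  have h0 : Real.exp (s q) ^ 2 ≠ 0 := by positivity
  set σ₀ := ∑ k, q.2 k * pdx k s q with hσ
  have h4 : ∀ j, fundInv (expMul s L) q i j *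
      ((∑ k, pdx k (pdy j (sq (expMul s L))) q * q.2 k) - pdx j (sq (expMul s L)) q)
      = fundInv L q i j * ((∑ k, pdx k (pdy j (sq L)) q * q.2 k) - pdx j (sq L) q)
        + 2 * σ₀ * (fundInv L q i j * pdy j (sq L) q)
        - 2 * sq L q * (fundInv L q i j * pdx j s q) := fun j => by
    have h5 : ∑ k, pdx k (pdy j (sq (expMul s L))) q * q.2 k
        = Real.exp (s q) ^ 2 * (∑ k, pdx k (pdy j (sq L)) q * q.2 k
          + 2 * σ₀ * pdy j (sq L) q) := by
      simp only [h1, hσ, Finset.mul_sum, Finset.sum_mul, ← Finset.sum_add_distrib]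
      exact Finset.sum_congr rfl fun _ _ => by ring
    rw [h5, h2, h.fundInv_expMul hq]
    field_simp
    ring
  simp only [spray, h4, Finset.sum_add_distrib, Finset.sum_sub_distrib, ← Finset.mul_sum, h3]
  ring

theorem pdy_pdx (h : IsConformalPair L s Ω) (hp : p ∈ Ω) (j m : Fin n) :
    pdy m (pdx j s) p = 0 := by
  have h1 : Set.EqOn (dirDeriv (0, basisVec m) s) (fun _ => 0) Ω := fun q hq => h.basic q hq _
  rw [pdy_eq_dirDeriv, pdx_eq_dirDeriv, dirDeriv_comm h.finsler.isOpen h.smooth hp,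
    dirDeriv_congr h.finsler.isOpen h1 _ hp, dirDeriv_const]

theorem contDiffOn_pdx (h : IsConformalPair L s Ω) (j : Fin n) : ContDiffOn ℝ ∞ (pdx j s) Ω :=
  contDiffOn_dirDeriv h.finsler.isOpen h.smooth _

/-- As `s` depends on `x` only, `y`-derivatives fall on `yⁱ`, `yᵏ`, `L²` and `g^{ij}`; the last
produces the Cartan tensor term. -/
theorem pdy_spray_expMul (h : IsConformalPair L s Ω) (hp : p ∈ Ω) (i m : Fin n) :
    pdy m (spray (expMul s L) i) p = pdy m (spray L i) p
      + (pdx m s p * p.2 i + (∑ k, pdx k s p * p.2 k) * (if i = m then 1 else 0)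
      - L p * pdy m L p * raise L p (fun j => pdx j s p) i
      + L p * ∑ a, ∑ b, fundInv L p i a * cartanCoeff L a b m p
          * raise L p (fun j => pdx j s p) b) := by
  have hF := h.finsler
  have h0 := hF.ne_zero hp
  have dd : ∀ {f : P n → ℝ}, ContDiffOn ℝ ∞ f Ω → DifferentiableAt ℝ f p :=
    fun hf => differentiableAt_of_contDiffOn hF.isOpen hf hp
  have hx := fun j => dd (h.contDiffOn_pdx j)
  have hg := fun j => dd (hF.contDiffOn_fundInv i j)
  have hy := fun j => dd (contDiff_fibreCoord (n := n) j).contDiffOn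
  have hs0 : DifferentiableAt ℝ (fun q : P n => ∑ k, q.2 k * pdx k s q) p :=
    DifferentiableAt.fun_sum fun k _ => (hy k).fun_mul (hx k)
  have hr : DifferentiableAt ℝ (fun q : P n => ∑ j, fundInv L q i j * pdx j s q) p :=
    DifferentiableAt.fun_sum fun j _ => (hg j).fun_mul (hx j)
  have hsq := dd hF.contDiffOn_sq
  have e1 : pdy m (fun q => ∑ k, q.2 k * pdx k s q) p = pdx m s p := by
    rw [dirDeriv_sum_fibreCoord_mul hx]
    simp [h.pdy_pdx hp]
  have e2 : pdy m (fun q => ∑ j, fundInv L q i j * pdx j s q) p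
      = ∑ j, pdx j s p * pdy m (fun q => fundInv L q i j) p := by
    rw [pdy_eq_dirDeriv, dirDeriv_sum fun j _ => (hg j).fun_mul (hx j)]
    simp only [dirDeriv_mul (hg _) (hx _), ← pdy_eq_dirDeriv, h.pdy_pdx hp, mul_zero, zero_add]
  have e3 : ∑ j, pdx j s p * pdy m (fun q => fundInv L q i j) p
      = -(2 / L p) * ∑ a, ∑ b, fundInv L p i a * cartanCoeff L a b m p
          * raise L p (fun j => pdx j s p) b := by
    simp only [hF.pdy_fundInv hp, raise, Finset.mul_sum]
    rw [Finset.sum_comm]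
    refine Finset.sum_congr rfl fun a _ => ?_
    rw [Finset.sum_comm]
    refine Finset.sum_congr rfl fun b _ => Finset.sum_congr rfl fun j _ => ?_
    ring
  rw [pdy_eq_dirDeriv, dirDeriv_congr hF.isOpen (h.spray_expMul i) _ hp,
    dirDeriv_add (dd (hF.contDiffOn_spray i))
      ((hs0.fun_mul (hy i)).fun_sub ((hsq.fun_mul hr).const_mul _)),
    dirDeriv_sub (hs0.fun_mul (hy i)) ((hsq.fun_mul hr).const_mul _),
    dirDeriv_mul hs0 (hy i), dirDeriv_const_mul (hsq.fun_mul hr), dirDeriv_mul hsq hr,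
    dirDeriv_fibreCoord, ← pdy_eq_dirDeriv, ← pdy_eq_dirDeriv, ← pdy_eq_dirDeriv,
    ← pdy_eq_dirDeriv, e1, e2, e3, hF.pdy_sq hp]
  simp only [basisVec_apply, sq, raise, mul_comm (p.2 _) (pdx _ s p)]
  field_simp
  ring

theorem sum_meanCartan_mul_pdy_spray (h : IsConformalPair L s Ω) (hp : p ∈ Ω) (m : Fin n) :
    ∑ i, meanCartan L i p / L p * (pdy m (spray (expMul s L) i) p - pdy m (spray L i) p)
      = conformalDefect L s m p := by
  have h0 := h.finsler.ne_zero hp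
  set σ := raise L p (fun j => pdx j s p) with hσ
  have hA : ∑ i, meanCartan L i p * ∑ a, ∑ b, fundInv L p i a * cartanCoeff L a b m p * σ b
      = ∑ a, ∑ b, cartanCoeff L a b m p * raise L p (fun i => meanCartan L i p) a * σ b := by
    simp only [raise, Finset.mul_sum, Finset.sum_mul]
    rw [Finset.sum_comm]
    refine Finset.sum_congr rfl fun a _ => ?_
    rw [Finset.sum_comm]
    refine Finset.sum_congr rfl fun b _ => Finset.sum_congr rfl fun i _ => ?_
    rw [h.finsler.fundInv_symm hp i a]
    ring
  have hy := h.finsler.sum_meanCartan_mul hp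
  set T : Fin n → ℝ := fun i => ∑ a, ∑ b, fundInv L p i a * cartanCoeff L a b m p * σ b with hT
  set σ₀ := ∑ k, pdx k s p * p.2 k with hσ₀
  have hd : ∀ i, pdy m (spray (expMul s L) i) p = pdy m (spray L i) p
      + (pdx m s p * p.2 i + σ₀ * (if i = m then 1 else 0) - L p * pdy m L p * σ i + L p * T i) :=
    fun i => h.pdy_spray_expMul hp i m
  calc _ = pdx m s p / L p * ∑ i, meanCartan L i p * p.2 i
        + σ₀ / L p * ∑ i, meanCartan L i p * (if i = m then 1 else 0)
        - pdy m L p * ∑ i, meanCartan L i p * σ i + ∑ i, meanCartan L i p * T i := by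
        simp only [Finset.mul_sum, ← Finset.sum_add_distrib, ← Finset.sum_sub_distrib]
        refine Finset.sum_congr rfl fun i _ => ?_
        rw [hd]
        field_simp
        ring
    _ = _ := by
        rw [hA, hy, conformalDefect]
        simp only [mul_ite, mul_one, mul_zero, Finset.sum_ite_eq', Finset.mem_univ, if_true]
        ring

/-- The fibre components of `X` enter both Cartan forms with the same coefficients `I_k / L`, so
they cancel and the difference is a form in `dx` alone. -/
theorem cartanForm_expMul_sub (h : IsConformalPair L s Ω) (hp : p ∈ Ω) (X : P n → P n) :
    cartanForm (expMul s L) X p - cartanForm L X p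
      = ∑ m, (X p).1 m * conformalDefect L s m p := by
  rw [h.isLocalFinsler_expMul.cartanForm_eq hp, h.finsler.cartanForm_eq hp]
  simp only [h.meanCartan_expMul hp, ← h.sum_meanCartan_mul_pdy_spray hp, vert_snd_apply,
    Finset.mul_sum, ← Finset.sum_sub_distrib]
  rw [Finset.sum_comm]
  refine Finset.sum_congr rfl fun k _ => ?_
  rw [← mul_sub, add_sub_add_left_eq_sub, ← Finset.sum_sub_distrib, Finset.mul_sum]
  exact Finset.sum_congr rfl fun _ _ => by ring

/-! ### Translation of the defect into the invariant equations. -/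

theorem sharp_of_horizontal (h : IsLocalFinsler L Ω) (hp : p ∈ Ω) {α : P n → ℝ} {a : Fin n → ℝ}
    (hx : ∀ i, α (deltaX L i p) = a i) (hy : ∀ i, α (deltaY L i p) = 0) :
    sharp L p α = ∑ j, raise L p a j • deltaX L j p := by
  simp only [sharp, hx, hy, mul_zero, zero_smul, Finset.sum_const_zero, add_zero, raise,
    Finset.sum_smul]
  rw [Finset.sum_comm]
  simp only [h.fundInv_symm hp]

theorem sharp_usualCartanForm (h : IsLocalFinsler L Ω) (hp : p ∈ Ω) :
    sharp L p (usualCartanForm L p)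
      = ∑ j, raise L p (fun i => meanCartan L i p) j • deltaX L j p :=
  sharp_of_horizontal h hp (fun i => by simp [usualCartanForm, deltaX_fst, basisVec_apply,
    meanCartan]) (fun i => by simp [usualCartanForm, deltaY])

theorem fderiv_deltaX (h : IsConformalPair L s Ω) (hp : p ∈ Ω) (i : Fin n) :
    fderiv ℝ s p (deltaX L i p) = pdx i s p := by
  have : deltaX L i p = (basisVec i, 0) + (0, (deltaX L i p).2) := by
    ext <;> simp [deltaX_fst]
  rw [this, map_add, h.basic p hp, add_zero, pdx]

theorem sharp_fderiv (h : IsConformalPair L s Ω) (hp : p ∈ Ω) :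
    sharp L p (fderiv ℝ s p) = ∑ j, raise L p (fun i => pdx i s p) j • deltaX L j p :=
  sharp_of_horizontal h.finsler hp (h.fderiv_deltaX hp) (fun _ => h.basic p hp _)

theorem along_reeb (h : IsConformalPair L s Ω) (hp : p ∈ Ω) :
    along (reeb L) s p = (∑ k, pdx k s p * p.2 k) / L p := by
  simp only [along, reeb, map_sum, map_smul, h.fderiv_deltaX hp, smul_eq_mul, Finset.sum_div]
  exact Finset.sum_congr rfl fun _ _ => by ring

theorem sasaki_sharp_sharp (h : IsConformalPair L s Ω) (hp : p ∈ Ω) :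
    sasaki L p (sharp L p (usualCartanForm L p)) (sharp L p (fderiv ℝ s p))
      = ∑ i, meanCartan L i p * raise L p (fun j => pdx j s p) i := by
  rw [sharp_usualCartanForm h.finsler hp, h.sharp_fderiv hp, sasaki_sum_smul_deltaX,
    Finset.sum_comm]
  refine Finset.sum_congr rfl fun j _ => ?_
  rw [← Finset.sum_mul]
  congr 1
  have hinv : ∀ k, ∑ i, fundMatrix L p j i * fundInv L p i k = if j = k then 1 else 0 :=
    fun k => by rw [← Matrix.mul_apply, h.finsler.mul_fundInv hp, Matrix.one_apply]
  calc _ = ∑ k, (∑ i, fundMatrix L p j i * fundInv L p i k) * meanCartan L k p := by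
        simp only [raise, Finset.mul_sum, Finset.sum_mul]
        rw [Finset.sum_comm]
        refine Finset.sum_congr rfl fun k _ => Finset.sum_congr rfl fun i _ => ?_
        rw [h.finsler.fundMatrix_symm hp i j]
        ring
    _ = _ := by simp [hinv]

theorem cartanTensor_sharp_sharp (h : IsConformalPair L s Ω) (hp : p ∈ Ω) (ξ : P n) :
    cartanTensor L p (sharp L p (usualCartanForm L p)) (sharp L p (fderiv ℝ s p)) ξ
      = ∑ m, (∑ a, ∑ b, cartanCoeff L a b m p * raise L p (fun i => meanCartan L i p) a
        * raise L p (fun j => pdx j s p) b) * ξ.1 m := by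
  have h1 : ∀ (c : Fin n → ℝ) i, (∑ j, c j • deltaX L j p).1 i = c i := fun c i => by
    simp [Prod.fst_sum, deltaX_fst, basisVec_apply]
  rw [sharp_usualCartanForm h.finsler hp, h.sharp_fderiv hp]
  simp only [cartanTensor, h1, Finset.sum_mul]
  rw [Finset.sum_comm_cycle]

/-- `A` and `I` annihilate `y`, so only the `dL` term survives. This extracts the scalar equation
from the vanishing of the defect. -/
theorem sum_conformalDefect_mul (h : IsConformalPair L s Ω) (hp : p ∈ Ω) :
    ∑ m, conformalDefect L s m p * p.2 m
      = -L p * ∑ i, meanCartan L i p * raise L p (fun j => pdx j s p) i := by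
  have h1 : ∑ m, (∑ a, ∑ b, cartanCoeff L a b m p * raise L p (fun i => meanCartan L i p) a
        * raise L p (fun j => pdx j s p) b) * p.2 m = 0 := by
    simp only [Finset.sum_mul]
    rw [Finset.sum_comm]
    refine Finset.sum_eq_zero fun a _ => ?_
    rw [Finset.sum_comm]
    refine Finset.sum_eq_zero fun b _ => ?_
    have := h.finsler.sum_cartanCoeff_mul hp a b
    calc _ = raise L p (fun i => meanCartan L i p) a * raise L p (fun j => pdx j s p) b
          * ∑ m, cartanCoeff L a b m p * p.2 m := by
          rw [Finset.mul_sum]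
          exact Finset.sum_congr rfl fun _ _ => by ring
      _ = 0 := by rw [this, mul_zero]
  simp only [conformalDefect, sub_mul, add_mul, Finset.sum_sub_distrib, Finset.sum_add_distrib, h1]
  simp only [mul_right_comm (pdy _ L p), mul_assoc ((∑ k, pdx k s p * p.2 k) / L p),
    ← Finset.mul_sum, ← Finset.sum_mul, h.finsler.sum_meanCartan_mul hp]
  have h2 := h.finsler.sum_mul_pdy hp
  simp only [mul_comm (p.2 _)] at h2
  rw [h2]
  ring

theorem conformalEqs_iff (h : IsConformalPair L s Ω) (hp : p ∈ Ω) :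
    ConformalEqs L s p ↔ ∀ m, conformalDefect L s m p = 0 := by
  set N := ∑ i, meanCartan L i p * raise L p (fun j => pdx j s p) i with hN
  have hform : ∀ ξ : P n, along (reeb L) s p * usualCartanForm L p ξ +
      cartanTensor L p (sharp L p (usualCartanForm L p)) (sharp L p (fderiv ℝ s p)) ξ
      = ∑ m, (conformalDefect L s m p + pdy m L p * N) * ξ.1 m := fun ξ => by
    rw [h.along_reeb hp, h.cartanTensor_sharp_sharp hp, usualCartanForm, Finset.mul_sum,
      ← Finset.sum_add_distrib]
    refine Finset.sum_congr rfl fun m _ => ?_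
    rw [conformalDefect, ← hN, meanCartan]
    ring
  simp only [ConformalEqs, hform, h.sasaki_sharp_sharp hp, ← hN]
  constructor
  · rintro ⟨h1, h2⟩ m
    simpa [h2, basisVec_apply] using h1 (basisVec m, 0)
  · intro h1
    have h2 := h.sum_conformalDefect_mul hp
    simp only [h1, zero_mul, Finset.sum_const_zero, ← hN] at h2
    have h3 : N = 0 := by
      rcases mul_eq_zero.1 h2.symm with h4 | h4
      · exact absurd (neg_eq_zero.1 h4) (h.finsler.ne_zero hp)
      · exact h4
    simp [h1, h3]

theorem cartanForm_expMul_eq_iff (h : IsConformalPair L s Ω) (hp : p ∈ Ω) (X : P n → P n) :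
    cartanForm (expMul s L) X p = cartanForm L X p ↔
      ∑ m, (X p).1 m * conformalDefect L s m p = 0 := by
  rw [← h.cartanForm_expMul_sub hp, sub_eq_zero]

end IsConformalPair

/-! ### Coordinate expressions of Finsler structures -/

theorem contMDiff_toTangentBundle :
    ContMDiff 𝓘(ℝ, P n) (𝓡 n).tangent ∞
      (fun p : P n => (⟨p.1, p.2⟩ : TangentBundle (𝓡 n) (E n))) := by
  intro p
  rw [Bundle.contMDiffAt_totalSpace]
  refine ⟨contDiff_fst.contMDiff.contMDiffAt, ?_⟩
  have : ContMDiffAt 𝓘(ℝ, P n) 𝓘(ℝ, E n) ∞ (fun q : P n => q.2) p :=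
    contDiff_snd.contMDiff.contMDiffAt
  refine this.congr_of_eventuallyEq (Filter.Eventually.of_forall fun q => ?_)
  simp

variable {M : Type*} [TopologicalSpace M]

theorem isOpen_slitDomain (e : OpenPartialHomeomorph M (E n)) : IsOpen (slitDomain e) :=
  (e.open_target.preimage continuous_fst).inter (isOpen_compl_singleton.preimage continuous_snd)

variable [ChartedSpace (E n) M] {F : TangentBundle (𝓡 n) M → ℝ} {σ : M → ℝ}
  {e : OpenPartialHomeomorph M (E n)}

/-- The axioms of `F` hold only off the zero section, so coordinate vectors `y ≠ 0` must stay
nonzero in `TM`. -/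
theorem mfderiv_symm_ne_zero (he : e ∈ IsManifold.maximalAtlas (𝓡 n) ∞ M) {p : P n}
    (hp : p ∈ slitDomain e) : mfderiv (𝓡 n) (𝓡 n) e.symm p.1 p.2 ≠ 0 := by
  have hmd : e.MDifferentiable (𝓡 n) (𝓡 n) :=
    ⟨(contMDiffOn_of_mem_maximalAtlas he).mdifferentiableOn (by simp),
      (contMDiffOn_symm_of_mem_maximalAtlas he).mdifferentiableOn (by simp)⟩
  intro h
  exact hp.2 (hmd.symm.mfderiv_injective hp.1 (h.trans (map_zero _).symm))

theorem contDiffOn_comp_symm (hσ : ContMDiff (𝓡 n) 𝓘(ℝ, ℝ) ∞ σ)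
    (he : e ∈ IsManifold.maximalAtlas (𝓡 n) ∞ M) :
    ContDiffOn ℝ ∞ (fun x => σ (e.symm x)) e.target := by
  rw [← contMDiffOn_iff_contDiffOn]
  exact hσ.comp_contMDiffOn (contMDiffOn_symm_of_mem_maximalAtlas he)

variable [IsManifold (𝓡 n) ∞ M]

theorem contDiffOn_localRep (hF : IsFinsler F) (he : e ∈ IsManifold.maximalAtlas (𝓡 n) ∞ M) :
    ContDiffOn ℝ ∞ (localRep F e) (slitDomain e) := by
  have : IsManifold (𝓡 n) 1 M := IsManifold.of_le (n := ∞) (by simp)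
  rw [← contMDiffOn_iff_contDiffOn]
  have h1 := (contMDiffOn_symm_of_mem_maximalAtlas he).contMDiffOn_tangentMapWithin
    (m := ∞) (by simp) e.open_target.uniqueMDiffOn
  have h2 := h1.comp (contMDiff_toTangentBundle.contMDiffOn (s := slitDomain e)) fun p hp => hp.1
  have h3 : Set.EqOn (tangentMapWithin (𝓡 n) (𝓡 n) e.symm e.target ∘
      fun p : P n => (⟨p.1, p.2⟩ : TangentBundle (𝓡 n) (E n)))
      (fun p => ⟨e.symm p.1, mfderiv (𝓡 n) (𝓡 n) e.symm p.1 p.2⟩) (slitDomain e) :=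
    fun p hp => by
      simp only [Function.comp, tangentMapWithin, mfderivWithin_of_isOpen e.open_target hp.1]
  exact hF.smooth.comp (h2.congr fun p hp => (h3 hp).symm) fun p hp => mfderiv_symm_ne_zero he hp

theorem isLocalFinsler_localRep (hF : IsFinsler F)
    (he : e ∈ IsManifold.maximalAtlas (𝓡 n) ∞ M) :
    IsLocalFinsler (localRep F e) (slitDomain e) where
  isOpen := isOpen_slitDomain e
  smooth := contDiffOn_localRep hF he
  pos p hp := hF.pos _ _ (mfderiv_symm_ne_zero he hp)
  euler p hp := by
    have hd := differentiableAt_of_contDiffOn (isOpen_slitDomain e) (contDiffOn_localRep hF he) hp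
    have hc : HasDerivAt (fun c : ℝ => ((p.1, c • p.2) : P n)) (0, p.2) 1 := by
      simpa using (hasDerivAt_const (1 : ℝ) p.1).prodMk ((hasDerivAt_id (1 : ℝ)).smul_const p.2)
    have h1 : HasDerivAt (fun c : ℝ => localRep F e (p.1, c • p.2))
        (fderiv ℝ (localRep F e) p (0, p.2)) 1 :=
      HasFDerivAt.comp_hasDerivAt_of_eq (1 : ℝ) hd.hasFDerivAt hc (by simp)
    have h2 : HasDerivAt (fun c : ℝ => c * localRep F e p) (localRep F e p) 1 := by
      simpa using (hasDerivAt_id (1 : ℝ)).mul_const (localRep F e p)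
    refine h1.unique (h2.congr_of_eventuallyEq ?_)
    -- Euler's relation is the derivative of `L(x, c y) = c L(x, y)` at `c = 1`; homogeneity is
    -- available for `c > 0`, which suffices near `1`.
    filter_upwards [lt_mem_nhds one_pos] with c hc
    have hm : mfderiv (𝓡 n) (𝓡 n) e.symm p.1 (c • p.2)
        = c • mfderiv (𝓡 n) (𝓡 n) e.symm p.1 p.2 := ContinuousLinearMap.map_smul _ c p.2
    simp only [localRep, hm]
    exact hF.homog _ _ (mfderiv_symm_ne_zero he hp) c hc
  posDef := hF.posDef e he

theorem isConformalPair_localRep (hF : IsFinsler F) (hσ : ContMDiff (𝓡 n) 𝓘(ℝ, ℝ) ∞ σ)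
    (he : e ∈ IsManifold.maximalAtlas (𝓡 n) ∞ M) :
    IsConformalPair (localRep F e) (localPull σ e) (slitDomain e) where
  finsler := isLocalFinsler_localRep hF he
  smooth := (contDiffOn_comp_symm hσ he).comp contDiffOn_fst fun p hp => hp.1
  basic p hp w := by
    have hd : DifferentiableAt ℝ (fun x => σ (e.symm x)) p.1 :=
      ((contDiffOn_comp_symm hσ he).contDiffAt
        (e.open_target.mem_nhds hp.1)).differentiableAt (by simp)
    have : HasFDerivAt (localPull σ e) ((fderiv ℝ (fun x => σ (e.symm x)) p.1).comp
        (ContinuousLinearMap.fst ℝ (E n) (E n))) p := hd.hasFDerivAt.comp p hasFDerivAt_fst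
    simp [this.fderiv]

end Finsler

end

theorem proposition3 {n : ℕ} {M : Type*} [TopologicalSpace M]
    [ChartedSpace (EuclideanSpace ℝ (Fin n)) M] [IsManifold (𝓡 n) ∞ M]
    (F : TangentBundle (𝓡 n) M → ℝ) (hF : Finsler.IsFinsler F)
    (σ : M → ℝ) (hσ : ContMDiff (𝓡 n) 𝓘(ℝ, ℝ) ∞ σ) :
    Finsler.CartanFormsAgree (Finsler.conformal σ F) F ↔
      ∀ e ∈ IsManifold.maximalAtlas (𝓡 n) ∞ M, ∀ p ∈ Finsler.slitDomain e,
        Finsler.ConformalEqs (Finsler.localRep F e) (Finsler.localPull σ e) p := by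
  refine forall₂_congr fun e he => ?_
  have h := Finsler.isConformalPair_localRep hF hσ he
  constructor
  · intro H p hp
    refine (h.conformalEqs_iff hp).2 fun m => ?_
    -- The constant field `∂/∂xᵐ` isolates the `m`-th component. The chart expression of `e^σ F` is
    -- `expMul` of the chart expressions by definition.
    have := (h.cartanForm_expMul_eq_iff hp _).1
      (H (fun _ => (Finsler.basisVec m, 0)) contDiffOn_const p hp)
    simpa [Finsler.basisVec_apply] using this
  · intro H X _ p hp
    refine (h.cartanForm_expMul_eq_iff hp X).2 ?_
    simp [(h.conformalEqs_iff hp).1 (H p hp)]
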